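/- Let $k$ be an arbitrary field of characteristic $p>0$, let $n\ge 1$, write $\boldsymbol t=(t_1,\dots,t_n)$, and let $f=\sum_{\boldsymbol i\in\mathbb N^n}a(\boldsymbol i)\,\boldsymbol t^{\boldsymbol i}\in k[[\boldsymbol t]]$ be algebraic over $k(\boldsymbol t)$. Let $d$ (the degree of $f$), $h$ (the total height of $f$) and $h_i$ for $1\le i\le n$ (the partial heights of $f$) be, respectively, the minimal degree in $y$, the minimal total degree in $\boldsymbol t$, and the minimal degree in $t_i$ of a nonzero polynomial $A(\boldsymbol t,y)\in k[\boldsymbol t,y]$ such that $A(\boldsymbol t,f)=0$ (each minimum being taken separately). Let $\Delta(f)=\sum_{i\ge 0}a(i,\dots,i)\,t^i\in k[[t]]$ be the diagonal of $f$, and set $$N=(d+1)\cdot\min\left\{\prod_{i=1}^n(h_i+1)-\prod_{i=1}^n h_i,\ \binom{n+h}{n}-\binom{h}{n}\right\}.$$ Then there exist $c_0,c_1,\dots,c_N\in k[t]$, not all zero, such that $$c_0\,\Delta(f)+c_1\,\Delta(f)^p+\cdots+c_N\,\Delta(f)^{p^N}=0.$$ In particular, $\Delta(f)$ is algebraic over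 $k(t)$, of degree at most $p^N-1$. -/

import Mathlib

namespace AlgSeries

/-- The degree of `f` over `R`: the minimal degree in `y` of a nonzero polynomial `A ∈ R[y]`
such that `A(f) = 0`.  (It is used for `R = k[t₁, …, tₙ]`, `f ∈ k[[t₁, …, tₙ]]`, and for
`R = k[t]`, `f ∈ k[[t]]`.  The infimum is over a nonempty set exactly when `f` is algebraic.) -/
noncomputable def degree (R : Type*) {S : Type*} [CommRing R] [CommRing S] [Algebra R S]
    (f : S) : ℕ :=
  sInf {m : ℕ | ∃ A : Polynomial R, A ≠ 0 ∧ Polynomial.aeval f A = 0 ∧ A.natDegree = m}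

section Heights

variable {k : Type*} [Field k] {n : ℕ}

/-- The degree in the variable `tᵢ` of `A ∈ k[t₁, …, tₙ][y]`. -/
noncomputable def degT (i : Fin n) (A : Polynomial (MvPolynomial (Fin n) k)) : ℕ :=
  A.support.sup fun j => (A.coeff j).degreeOf i

/-- The total degree in `t = (t₁, …, tₙ)` of `A ∈ k[t₁, …, tₙ][y]`. -/
noncomputable def totalDegT (A : Polynomial (MvPolynomial (Fin n) k)) : ℕ :=
  A.support.sup fun j => (A.coeff j).totalDegree

/-- The `i`-th partial height of `f ∈ k[[t₁, …, tₙ]]`: the minimal degree in `tᵢ` of a nonzero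
polynomial `A ∈ k[t₁, …, tₙ, y]` such that `A(t, f) = 0`. -/
noncomputable def partialHeight (f : MvPowerSeries (Fin n) k) (i : Fin n) : ℕ :=
  sInf {m : ℕ | ∃ A : Polynomial (MvPolynomial (Fin n) k),
    A ≠ 0 ∧ Polynomial.aeval f A = 0 ∧ degT i A = m}

/-- The total height of `f ∈ k[[t₁, …, tₙ]]`: the minimal total degree in `t` of a nonzero
polynomial `A ∈ k[t₁, …, tₙ, y]` such that `A(t, f) = 0`. -/
noncomputable def totalHeight (f : MvPowerSeries (Fin n) k) : ℕ :=
  sInf {m : ℕ | ∃ A : Polynomial (MvPolynomial (Fin n) k),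
    A ≠ 0 ∧ Polynomial.aeval f A = 0 ∧ totalDegT A = m}

/-- The diagonal `Δ(f) = ∑ᵢ a(i, …, i) tⁱ` of `f = ∑ a(i₁, …, iₙ) t₁^i₁ ⋯ tₙ^iₙ`. -/
noncomputable def diagonal (f : MvPowerSeries (Fin n) k) : PowerSeries k :=
  PowerSeries.mk fun i => MvPowerSeries.coeff (Finsupp.equivFunOnFinite.symm fun _ => i) f

end Heights

end AlgSeries

/-! After passing to the algebraic closure `K`, every coefficient has a `p`-th root, and the section
operators `cartier p r` act on `K[[t]]`. Let `A` be a minimal annihilating polynomial of `f`. It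
divides every annihilator, so it satisfies all the degree and height bounds at once
(`exists_prime_annihilator`, `le_of_coeff_mul_le`), and `A'(f) ≠ 0` (`aeval_derivative_ne_zero`).

Let `V` be the set of `Q(f) / A'(f)` in `K[[t]]` with `deg Q < d` and the coefficients of `Q`
subject to the height bounds of `A`. It contains `f`, and it is stable under the sections with
indices below `p` (`cartier_mem_quotientsIn`). Since `Δ(w) = ∑ tˢ Δ(Λₛ w)^p`, every element of
`Δ(V)` is a `k[t]`-combination of `p`-th powers from `Δ(V)`, with `K` in place of `k`.

Multiplication by `t` on diagonals lifts to multiplication by `t₁⋯tₙ`, so `Δ(V)` has rank at most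
`d` times the number of admissible exponents with a zero entry (`not_linearIndependent_diagonal`).
Iterating the Frobenius relation puts all `Δ(f)^(p^l)` into a space of that dimension
(`not_linearIndependent_pow`), which forces a relation. A linear functional `K → k` brings it back
to `k`. -/

namespace AlgSeries

/-! ### Section operators in characteristic `p`. -/

section Cartier

variable {σ K : Type*} [Field K] (p : ℕ) [Fact p.Prime] [CharP K p]

open MvPowerSeries in
theorem coeff_smul_pow_char (u : MvPowerSeries σ K) (m : σ →₀ ℕ) :
    coeff (p • m) (u ^ p) = coeff m u ^ p := by
  have hp : p ≠ 0 := (Fact.out : p.Prime).ne_zero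
  rw [← map_frobenius_expand p hp, coeff_map, coeff_expand_smul, frobenius_def]

open MvPowerSeries in
theorem exists_eq_smul_of_coeff_pow_char_ne_zero (u : MvPowerSeries σ K) (m : σ →₀ ℕ)
    (h : coeff m (u ^ p) ≠ 0) : ∃ a, m = p • a := by
  have hp : p ≠ 0 := (Fact.out : p.Prime).ne_zero
  have hd : ∀ i, p ∣ m i := by
    intro i
    by_contra hi
    apply h
    rw [← map_frobenius_expand p hp, coeff_map, coeff_expand_of_not_dvd p hp u hi, map_zero]
  refine ⟨m.mapRange (· / p) (Nat.zero_div p), ?_⟩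
  ext i
  simp [Nat.mul_div_cancel' (hd i)]

theorem coeff_mul_pow_char (u : PowerSeries K) (m : ℕ) :
    PowerSeries.coeff (p * m) (u ^ p) = PowerSeries.coeff m u ^ p := by
  have := coeff_smul_pow_char p (σ := Unit) u (Finsupp.single () m)
  rw [Finsupp.smul_single, smul_eq_mul] at this
  exact this

theorem dvd_of_coeff_pow_char_ne_zero (u : PowerSeries K) (m : ℕ)
    (h : PowerSeries.coeff m (u ^ p) ≠ 0) : p ∣ m := by
  obtain ⟨a, ha⟩ := exists_eq_smul_of_coeff_pow_char_ne_zero p (σ := Unit) u (Finsupp.single () m) h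
  have := DFunLike.congr_fun ha ()
  simp only [Finsupp.single_eq_same, Finsupp.smul_apply, smul_eq_mul] at this
  exact ⟨_, this⟩

variable [PerfectRing K p]

/-- The section operator with index `r`: the coefficient at `m` of `cartier p r g` is the `p`-th
root of the coefficient at `r + p • m` of `g`. -/
noncomputable def cartier (r : σ →₀ ℕ) : MvPowerSeries σ K →+ MvPowerSeries σ K where
  toFun g := fun m => (frobeniusEquiv K p).symm (MvPowerSeries.coeff (r + p • m) g)
  map_zero' := by
    funext m
    exact (congrArg _ (map_zero (MvPowerSeries.coeff (r + p • m)))).trans (map_zero _)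
  map_add' u v := by
    funext m
    exact (congrArg _ (map_add (MvPowerSeries.coeff (r + p • m)) u v)).trans (map_add _ _ _)

theorem coeff_cartier (r : σ →₀ ℕ) (g : MvPowerSeries σ K) (m : σ →₀ ℕ) :
    MvPowerSeries.coeff m (cartier p r g) =
      (frobeniusEquiv K p).symm (MvPowerSeries.coeff (r + p • m) g) := rfl

theorem coeff_cartier_pow (r : σ →₀ ℕ) (g : MvPowerSeries σ K) (m : σ →₀ ℕ) :
    MvPowerSeries.coeff m (cartier p r g) ^ p = MvPowerSeries.coeff (r + p • m) g := by
  rw [coeff_cartier, frobeniusEquiv_symm_pow_p]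

-- The exponents of `u ^ p` are multiples `p • a`, so only pairs `(p • a, r + p • b)` contribute at
-- `r + p • m`; the bound `r i < p` is what forces `a ≤ m`.
open MvPowerSeries in
theorem cartier_pow_mul {r : σ →₀ ℕ} (hr : ∀ i, r i < p) (u v : MvPowerSeries σ K) :
    cartier p r (u ^ p * v) = u * cartier p r v := by
  classical
  have hp : p ≠ 0 := (Fact.out : p.Prime).ne_zero
  ext m
  apply (frobenius_inj K p)
  rw [frobenius_def, frobenius_def, coeff_cartier_pow, coeff_mul, coeff_mul, sum_pow_char]
  symm
  refine Finset.sum_of_injOn (fun x => (p • x.1, r + p • x.2)) ?_ ?_ ?_ ?_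
  · rintro ⟨a, b⟩ - ⟨a', b'⟩ - h
    simp only [Prod.mk.injEq, add_right_inj] at h
    have inj := smul_right_injective (σ →₀ ℕ) hp
    rw [Prod.mk.injEq]
    exact ⟨inj h.1, inj h.2⟩
  · rintro ⟨a, b⟩ h
    simp only [Finset.mem_coe, Finset.HasAntidiagonal.mem_antidiagonal] at h ⊢
    rw [← h, smul_add]; abel
  · rintro ⟨x, y⟩ h hn
    by_contra h0
    obtain ⟨a, rfl⟩ := exists_eq_smul_of_coeff_pow_char_ne_zero p u x (left_ne_zero_of_mul h0)
    rw [Finset.HasAntidiagonal.mem_antidiagonal] at h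
    have ham : a ≤ m := by
      intro i
      have h1 := DFunLike.congr_fun h i
      simp only [Finsupp.add_apply, Finsupp.smul_apply, smul_eq_mul] at h1
      have h2 := hr i
      by_contra h3
      have : p * (m i + 1) ≤ p * a i := Nat.mul_le_mul_left _ (by omega)
      rw [mul_add] at this
      omega
    obtain ⟨b, rfl⟩ := exists_add_of_le ham
    apply hn
    refine ⟨(a, b), by simp, ?_⟩
    simp only [Prod.mk.injEq, true_and]
    rw [smul_add, add_left_comm] at h
    exact (add_left_cancel h).symm
  · rintro ⟨a, b⟩ -
    rw [mul_pow, coeff_cartier_pow, coeff_smul_pow_char]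

end Cartier

/-! ### Diagonals, their sections, and the action of `t₁⋯tₙ`. -/

section Diagonal

variable {K : Type*} [Field K] {n : ℕ}

/-- The exponent `(s, …, s)`. -/
noncomputable def diagExp (n s : ℕ) : Fin n →₀ ℕ := Finsupp.equivFunOnFinite.symm fun _ => s

@[simp] theorem diagExp_apply (s : ℕ) (i : Fin n) : diagExp n s i = s := rfl

theorem coeff_diagonal (w : MvPowerSeries (Fin n) K) (m : ℕ) :
    PowerSeries.coeff m (diagonal w) = MvPowerSeries.coeff (diagExp n m) w :=
  PowerSeries.coeff_mk _ _

theorem diagonal_add (u v : MvPowerSeries (Fin n) K) :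
    diagonal (u + v) = diagonal u + diagonal v := by
  ext m; simp [coeff_diagonal]

theorem diagonal_zero : diagonal (0 : MvPowerSeries (Fin n) K) = 0 := by
  ext m; simp [coeff_diagonal]

theorem diagonal_sum {ι : Type*} (s : Finset ι) (u : ι → MvPowerSeries (Fin n) K) :
    diagonal (∑ i ∈ s, u i) = ∑ i ∈ s, diagonal (u i) :=
  map_sum (⟨⟨diagonal, diagonal_zero⟩, diagonal_add⟩ : MvPowerSeries (Fin n) K →+ PowerSeries K) u s

/-- Sort the diagonal exponents by residue `s` mod `p`: the class of `s` is seen exactly by the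
section with index `(s, …, s)`. -/
theorem diagonal_eq_sum_cartier (p : ℕ) [Fact p.Prime] [CharP K p] [PerfectRing K p]
    (w : MvPowerSeries (Fin n) K) :
    diagonal w = ∑ s ∈ Finset.range p,
      PowerSeries.X ^ s * diagonal (cartier p (diagExp n s) w) ^ p := by
  have hp : 0 < p := (Fact.out : p.Prime).pos
  ext m
  rw [map_sum, Finset.sum_eq_single (m % p)]
  · conv_rhs => rw [← Nat.mod_add_div m p]
    rw [Nat.mod_add_div m p]
    rw [PowerSeries.coeff_X_pow_mul', if_pos (Nat.mod_le _ _)]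
    have : m - m % p = p * (m / p) := by have := Nat.mod_add_div m p; omega
    have hm : diagExp n (m % p) + p • diagExp n (m / p) = diagExp n m :=
      Finsupp.ext fun i => Nat.mod_add_div m p
    rw [this, coeff_mul_pow_char, coeff_diagonal, coeff_diagonal, coeff_cartier_pow, hm]
  · intro s hs hsm
    rw [PowerSeries.coeff_X_pow_mul']
    split_ifs with h
    · by_contra h0
      have := dvd_of_coeff_pow_char_ne_zero p _ _ h0
      apply hsm
      have h1 := (Nat.modEq_iff_dvd' h).2 this
      rw [← h1, Nat.mod_eq_of_lt (Finset.mem_range.1 hs)]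
    · rfl
  · intro h
    exact absurd (Finset.mem_range.2 (Nat.mod_lt _ hp)) h

/-- The product `t₁ ⋯ tₙ`, as a power series. -/
noncomputable def diagVar (K : Type*) [Field K] (n : ℕ) : MvPowerSeries (Fin n) K :=
  MvPowerSeries.monomial (diagExp n 1) 1

theorem diagVar_pow (m : ℕ) :
    diagVar K n ^ m = MvPowerSeries.monomial (diagExp n m) 1 := by
  have hm : m • diagExp n 1 = diagExp n m := Finsupp.ext fun i => mul_one m
  rw [diagVar, MvPowerSeries.monomial_pow, one_pow, hm]

theorem diagonal_aeval_mul (hn : 1 ≤ n) (c : Polynomial K) (w : MvPowerSeries (Fin n) K) :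
    diagonal (Polynomial.aeval (diagVar K n) c * w) = (c : PowerSeries K) * diagonal w := by
  induction c using Polynomial.induction_on' with
  | add a b ha hb => rw [map_add, add_mul, diagonal_add, ha, hb, Polynomial.coe_add, add_mul]
  | monomial m a =>
    ext l
    have h1 : (Polynomial.monomial m a : PowerSeries K) = PowerSeries.C a * PowerSeries.X ^ m := by
      rw [← Polynomial.C_mul_X_pow_eq_monomial]; simp
    have h2 : algebraMap K (MvPowerSeries (Fin n) K) a = MvPowerSeries.C a := rfl
    rw [Polynomial.aeval_monomial, diagVar_pow, coeff_diagonal, h1, h2, mul_assoc, mul_assoc,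
      MvPowerSeries.coeff_C_mul, PowerSeries.coeff_C_mul, PowerSeries.coeff_X_pow_mul',
      MvPowerSeries.coeff_monomial_mul]
    congr 1
    have hle : diagExp n m ≤ diagExp n l ↔ m ≤ l := ⟨fun h => h ⟨0, hn⟩, fun h i => h⟩
    have hsub : diagExp n l - diagExp n m = diagExp n (l - m) := Finsupp.ext fun i => rfl
    simp only [hle, hsub, coeff_diagonal, one_mul]

end Diagonal

/-! ### Control of exponents in products and powers. -/

section Support

variable {σ K : Type*} [Field K]

/-- The power series all of whose exponents lie in `E`. -/
def suppIn (K : Type*) [Field K] (E : Set (σ →₀ ℕ)) : AddSubgroup (MvPowerSeries σ K) where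
  carrier := {u | ∀ m, MvPowerSeries.coeff m u ≠ 0 → m ∈ E}
  zero_mem' m h := absurd (map_zero _) h
  add_mem' {u v} hu hv m h := by
    by_contra hm
    have h1 : MvPowerSeries.coeff m u = 0 := by by_contra h'; exact hm (hu m h')
    have h2 : MvPowerSeries.coeff m v = 0 := by by_contra h'; exact hm (hv m h')
    exact h (by rw [map_add, h1, h2, add_zero])
  neg_mem' {u} hu m h := hu m (by rwa [map_neg, neg_ne_zero] at h)

theorem mul_mem_suppIn {E F G : Set (σ →₀ ℕ)} (hE : ∀ a ∈ E, ∀ b ∈ F, a + b ∈ G)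
    {u v : MvPowerSeries σ K} (hu : u ∈ suppIn K E) (hv : v ∈ suppIn K F) :
    u * v ∈ suppIn K G := by
  classical
  intro m h
  rw [MvPowerSeries.coeff_mul] at h
  obtain ⟨x, hx, hne⟩ := Finset.exists_ne_zero_of_sum_ne_zero h
  rw [← Finset.HasAntidiagonal.mem_antidiagonal.1 hx]
  exact hE _ (hu _ (left_ne_zero_of_mul hne)) _ (hv _ (right_ne_zero_of_mul hne))

theorem coeff_mul_mem_suppIn {E F G : Set (σ →₀ ℕ)} (hE : ∀ a ∈ E, ∀ b ∈ F, a + b ∈ G)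
    {P Q : Polynomial (MvPowerSeries σ K)} (hP : ∀ j, P.coeff j ∈ suppIn K E)
    (hQ : ∀ j, Q.coeff j ∈ suppIn K F) (j : ℕ) : (P * Q).coeff j ∈ suppIn K G := by
  rw [Polynomial.coeff_mul]
  exact sum_mem fun x _ => mul_mem_suppIn hE (hP _) (hQ _)

theorem coeff_pow_mem_suppIn {E : ℕ → Set (σ →₀ ℕ)} (h0 : 0 ∈ E 0)
    (hE : ∀ a b, ∀ x ∈ E a, ∀ y ∈ E b, x + y ∈ E (a + b))
    {P : Polynomial (MvPowerSeries σ K)} (hP : ∀ j, P.coeff j ∈ suppIn K (E 1)) (m : ℕ) :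
    ∀ j, (P ^ m).coeff j ∈ suppIn K (E m) := by
  classical
  induction m with
  | zero =>
    intro j
    rw [pow_zero, Polynomial.coeff_one]
    split_ifs
    · intro l hl
      rw [MvPowerSeries.coeff_one] at hl
      by_cases h : l = 0
      · rwa [h]
      · simp [h] at hl
    · exact zero_mem _
  | succ m ih =>
    rw [pow_succ]
    exact coeff_mul_mem_suppIn (hE m 1) ih hP

end Support

/-! ### Stability of the quotients by `A'(f)` under sections. -/

section PolyCartier

variable {σ K : Type*} [Field K] (p : ℕ) [Fact p.Prime] [CharP K p] [PerfectRing K p]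

open Polynomial

/-- The section operator on `K[[t]][y]` with index `r` in `t` and index `p - 1` in `y`. -/
noncomputable def polyCartier (r : σ →₀ ℕ) (G : (MvPowerSeries σ K)[X]) : (MvPowerSeries σ K)[X] :=
  ∑ l ∈ Finset.range (G.natDegree + 1), monomial l (cartier p r (G.coeff (p * l + (p - 1))))

theorem coeff_polyCartier (r : σ →₀ ℕ) (G : (MvPowerSeries σ K)[X]) (l : ℕ) :
    (polyCartier p r G).coeff l = cartier p r (G.coeff (p * l + (p - 1))) := by
  have hp : 0 < p := (Fact.out : p.Prime).pos
  rw [polyCartier, finsetSum_coeff]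
  simp only [coeff_monomial, Finset.sum_ite_eq', Finset.mem_range]
  split_ifs with h
  · rfl
  · rw [coeff_eq_zero_of_natDegree_lt, map_zero]
    have : 1 * l ≤ p * l := Nat.mul_le_mul_right _ hp
    omega

theorem polyCartier_add (r : σ →₀ ℕ) (G H : (MvPowerSeries σ K)[X]) :
    polyCartier p r (G + H) = polyCartier p r G + polyCartier p r H := by
  ext1 l; simp only [coeff_polyCartier, coeff_add, map_add]

theorem polyCartier_pow_mul {r : σ →₀ ℕ} (hr : ∀ i, r i < p) (G H : (MvPowerSeries σ K)[X]) :
    polyCartier p r (G ^ p * H) = G * polyCartier p r H := by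
  have hp : 0 < p := (Fact.out : p.Prime).pos
  have : CharP (MvPowerSeries σ K) p := charP_of_injective_algebraMap
    (algebraMap K (MvPowerSeries σ K)).injective p
  induction G using Polynomial.induction_on' with
  | add a b ha hb => rw [add_pow_char, add_mul, polyCartier_add, ha, hb, add_mul]
  | monomial i g =>
    ext1 l
    rw [coeff_polyCartier, ← C_mul_X_pow_eq_monomial, mul_pow, ← C_pow, ← pow_mul, mul_assoc,
      mul_assoc, coeff_C_mul, coeff_C_mul, cartier_pow_mul p hr, coeff_X_pow_mul', coeff_X_pow_mul',
      coeff_polyCartier]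
    congr 1
    by_cases h : i ≤ l
    · obtain ⟨j, rfl⟩ := Nat.exists_eq_add_of_le h
      have h2 : p * (i + j) + (p - 1) - i * p = p * (i + j - i) + (p - 1) := by
        rw [Nat.add_sub_cancel_left, mul_add, mul_comm i p, add_assoc, Nat.add_sub_cancel_left]
      rw [if_pos h, if_pos, h2]
      nlinarith
    · rw [if_neg h, if_neg, map_zero]
      have : p * (l + 1) ≤ p * i := Nat.mul_le_mul_left _ (by omega)
      rw [mul_comm i p]
      rw [mul_add] at this
      omega

/-- The power series `w` such that `w * A'(f) = Q(f)` for a polynomial `Q` of degree less than `d`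
with exponents in `E`. -/
def quotientsIn (A : (MvPowerSeries σ K)[X]) (f : MvPowerSeries σ K) (d : ℕ) (E : Set (σ →₀ ℕ)) :
    Set (MvPowerSeries σ K) :=
  {w | ∃ Q : (MvPowerSeries σ K)[X], Q.degree < d ∧ (∀ j, Q.coeff j ∈ suppIn K E) ∧
    Q.eval f = w * A.derivative.eval f}

/-- The witness `y A' - d A` has value `f A'(f)` at `f`. Its coefficients are integer multiples of
those of `A`, and the one of `y^d` cancels. -/
theorem self_mem_quotientsIn {A : (MvPowerSeries σ K)[X]} {f : MvPowerSeries σ K} {d : ℕ}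
    {E : Set (σ →₀ ℕ)} (hA : ∀ j, A.coeff j ∈ suppIn K E) (hd : A.natDegree ≤ d)
    (hf : A.eval f = 0) : f ∈ quotientsIn A f d E := by
  have hc : ∀ j : ℕ, (X * A.derivative - d • A).coeff j = ((j : ℤ) - d) • A.coeff j := by
    intro j
    rw [coeff_sub, coeff_smul]
    cases j with
    | zero => simp
    | succ j =>
      rw [coeff_X_mul, coeff_derivative]
      simp only [sub_smul, zsmul_eq_mul, nsmul_eq_mul, Int.cast_natCast, Nat.cast_succ, Int.cast_add,
        Int.cast_one]
      ring
  refine ⟨X * A.derivative - d • A, ?_, fun j => ?_, ?_⟩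
  · rw [degree_lt_iff_coeff_zero]
    intro m hm
    rw [hc]
    rcases hm.eq_or_lt with rfl | h
    · simp
    · rw [coeff_eq_zero_of_natDegree_lt (hd.trans_lt h), smul_zero]
  · rw [hc]
    exact zsmul_mem (hA j) _
  · simp [hf]

/-- An algebraic form of a residue computation: `w` is the residue of `Q / A` at `y = f`, and the
section of index `p - 1` in `y` commutes with residues. Writing `Q / A = Q A^(p-1) / A^p` makes the
denominator a `p`-th power, so the new numerator is the section of `Q A^(p-1)`. -/
theorem cartier_mem_quotientsIn {A : (MvPowerSeries σ K)[X]} {f : MvPowerSeries σ K} {d : ℕ}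
    {E : ℕ → Set (σ →₀ ℕ)} (h0 : 0 ∈ E 0)
    (hE : ∀ a b, ∀ x ∈ E a, ∀ y ∈ E b, x + y ∈ E (a + b))
    {r : σ →₀ ℕ} (hr : ∀ i, r i < p) (hEr : ∀ i, r + p • i ∈ E p → i ∈ E 1)
    (hA : ∀ j, A.coeff j ∈ suppIn K (E 1)) (hd : A.natDegree ≤ d) (hf : A.eval f = 0)
    {w : MvPowerSeries σ K} (hw : w ∈ quotientsIn A f d (E 1)) :
    cartier p r w ∈ quotientsIn A f d (E 1) := by
  have hp : 0 < p := (Fact.out : p.Prime).pos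
  obtain ⟨Q, hQd, hQE, hQ⟩ := hw
  obtain ⟨B, hB⟩ : X - C f ∣ A := dvd_iff_isRoot.2 hf
  have hD : A.derivative.eval f = B.eval f := by rw [hB]; simp [derivative_mul]
  obtain ⟨R, hR⟩ : X - C f ∣ Q - C w * B := by
    rw [dvd_iff_isRoot, IsRoot.def]; simp [hQ, hD]
  have hpow : ∀ G : (MvPowerSeries σ K)[X], G ^ p = G * G ^ (p - 1) := fun G => by
    rw [← pow_succ', Nat.sub_add_cancel hp]
  have key : Q * A ^ (p - 1) =
      B ^ p * (C w * (X - C f) ^ (p - 1)) + (X - C f) ^ p * (R * B ^ (p - 1)) := by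
    rw [eq_add_of_sub_eq hR, hpow B, hpow (X - C f), hB, mul_pow]
    ring
  have hm : (p - 1) * (X - C f).natDegree = p - 1 := by rw [natDegree_X_sub_C, mul_one]
  -- `(y - f)^(p-1)` is monic of degree `p - 1`, so the index `p - 1` picks out its leading
  -- coefficient only.
  have hlast : polyCartier p r (C w * (X - C f) ^ (p - 1)) = C (cartier p r w) := by
    ext1 l
    rw [coeff_polyCartier, coeff_C_mul, coeff_C]
    split_ifs with hl
    · have := ((monic_X_sub_C f).pow (p - 1)).coeff_natDegree
      rw [natDegree_pow, hm] at this
      rw [hl, mul_zero, zero_add, this, mul_one]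
    · rw [coeff_eq_zero_of_natDegree_lt, mul_zero, map_zero]
      rw [natDegree_pow, hm]
      have := Nat.mul_pos hp (Nat.pos_of_ne_zero hl)
      omega
  refine ⟨polyCartier p r (Q * A ^ (p - 1)), ?_, fun j => ?_, ?_⟩
  -- The degree of `Q A^(p-1)` is below `d + (p - 1) d = p d`, hence its section has degree below
  -- `d`.
  · rw [degree_lt_iff_coeff_zero]
    intro m hm
    rw [coeff_polyCartier]
    by_cases hQ0 : Q = 0
    · simp [hQ0]
    rw [coeff_eq_zero_of_natDegree_lt, map_zero]
    have h1 : Q.natDegree < d := (natDegree_lt_iff_degree_lt hQ0).2 hQd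
    have h2 : (A ^ (p - 1)).natDegree ≤ (p - 1) * d :=
      natDegree_pow_le.trans (Nat.mul_le_mul_left _ hd)
    have h3 : (Q * A ^ (p - 1)).natDegree ≤ Q.natDegree + (A ^ (p - 1)).natDegree := natDegree_mul_le
    have h4 : p * d ≤ p * m := Nat.mul_le_mul_left _ hm
    have h5 : p * d = (p - 1) * d + d := by
      rw [← Nat.succ_mul, Nat.succ_eq_add_one, Nat.sub_add_cancel hp]
    omega
  · rw [coeff_polyCartier]
    intro m hm
    apply hEr
    have h1 := coeff_mul_mem_suppIn (G := E p)
      (fun a ha b hb => by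
        have := hE 1 (p - 1) a ha b hb
        rwa [Nat.add_sub_cancel' hp] at this)
      hQE (coeff_pow_mem_suppIn h0 hE hA (p - 1))
    refine h1 (p * j + (p - 1)) _ fun h => hm ?_
    rw [coeff_cartier, h, map_zero]
  · rw [key, polyCartier_add, polyCartier_pow_mul p hr, polyCartier_pow_mul p hr, hlast, hD]
    simp [mul_comm]

end PolyCartier

/-! ### The rank of the space of diagonals. -/

section Rank

variable {K : Type*} [Field K] {n : ℕ}

open Polynomial

theorem exists_sum_aeval_diagVar {E : Set (Fin n →₀ ℕ)} (hfin : E.Finite)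
    (E₀ : Finset (Fin n →₀ ℕ)) (hE : ∀ m ∈ E, ∃ e ∈ E₀, ∃ s, m = e + diagExp n s)
    {u : MvPowerSeries (Fin n) K} (hu : u ∈ suppIn K E) :
    ∃ P : E₀ → K[X], u = ∑ e, aeval (diagVar K n) (P e) * MvPowerSeries.monomial e.1 1 := by
  classical
  have hmon : ∀ m ∈ E, ∀ a : K, ∃ P : E₀ → K[X], MvPowerSeries.monomial m a =
      ∑ e, aeval (diagVar K n) (P e) * MvPowerSeries.monomial e.1 1 := by
    intro m hm a
    obtain ⟨e, he, s, rfl⟩ := hE m hm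
    refine ⟨Pi.single ⟨e, he⟩ (monomial s a), ?_⟩
    rw [Finset.sum_eq_single ⟨e, he⟩]
    · rw [Pi.single_eq_same, aeval_monomial, diagVar_pow, MvPowerSeries.algebraMap_apply,
        mul_assoc, MvPowerSeries.monomial_mul_monomial, ← MvPowerSeries.monomial_zero_eq_C_apply,
        MvPowerSeries.monomial_mul_monomial]
      simp [add_comm]
    · intro b _ hb
      rw [Pi.single_eq_of_ne hb, map_zero, zero_mul]
    · simp
  choose! P hP using hmon
  refine ⟨fun e => ∑ m ∈ hfin.toFinset, P m (MvPowerSeries.coeff m u) e, ?_⟩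
  have hsum : u = ∑ m ∈ hfin.toFinset, MvPowerSeries.monomial m (MvPowerSeries.coeff m u) := by
    ext l
    simp only [map_sum, MvPowerSeries.coeff_monomial, Finset.sum_ite_eq, Set.Finite.mem_toFinset]
    split_ifs with h
    · rfl
    · by_contra h'
      exact h (hu l h')
  conv_lhs => rw [hsum]
  rw [Finset.sum_congr rfl fun m hm => hP m (hfin.mem_toFinset.1 hm) _, Finset.sum_comm]
  simp only [map_sum, Finset.sum_mul]

/-- The products `w l * A'(f)` are combinations of the `d * E₀.card` elements `tᵉ f^j` over
polynomials in `t₁⋯tₙ`. One vector too many gives a relation between the coordinate vectors;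
cancelling `A'(f)` and taking diagonals preserves it. The `tᵉ f^j` need only span. -/
theorem not_linearIndependent_diagonal (hn : 1 ≤ n) {E : Set (Fin n →₀ ℕ)} (hfin : E.Finite)
    (E₀ : Finset (Fin n →₀ ℕ)) (hE : ∀ m ∈ E, ∃ e ∈ E₀, ∃ s, m = e + diagExp n s)
    {A : (MvPowerSeries (Fin n) K)[X]} {f : MvPowerSeries (Fin n) K} {d : ℕ}
    (hD : A.derivative.eval f ≠ 0) (w : Fin (d * E₀.card + 1) → MvPowerSeries (Fin n) K)
    (hw : ∀ l, w l ∈ quotientsIn A f d E) :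
    ¬ LinearIndependent K[X] fun l => diagonal (w l) := by
  have hP : ∀ l, ∃ P : Fin d × E₀ → K[X], w l * A.derivative.eval f =
      ∑ x, aeval (diagVar K n) (P x) * (MvPowerSeries.monomial x.2.1 1 * f ^ x.1.1) := by
    intro l
    obtain ⟨Q, hQd, hQE, hQ⟩ := hw l
    choose P hP using fun j => exists_sum_aeval_diagVar hfin E₀ hE (hQE j)
    refine ⟨fun x => P x.1 x.2, ?_⟩
    have hsum : Q.eval f = ∑ j ∈ Finset.range d, Q.coeff j * f ^ j := by
      by_cases h : Q = 0
      · simp [h]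
      · exact eval_eq_sum_range' ((natDegree_lt_iff_degree_lt h).2 hQd) f
    rw [← hQ, Fintype.sum_prod_type, hsum, Finset.sum_range]
    refine Finset.sum_congr rfl fun j _ => ?_
    rw [hP j, Finset.sum_mul]
    simp only [mul_assoc]
  choose P hP using hP
  have hdep : ¬ LinearIndependent K[X] P := by
    intro h
    have := h.fintype_card_le_finrank
    simp at this
  rw [Fintype.not_linearIndependent_iff] at hdep ⊢
  obtain ⟨c, hc, hne⟩ := hdep
  refine ⟨c, ?_, hne⟩
  have hzero : ∑ l, aeval (diagVar K n) (c l) * w l = 0 := by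
    refine (mul_eq_zero.1 ?_).resolve_right hD
    rw [Finset.sum_mul]
    simp only [mul_assoc, hP, Finset.mul_sum]
    rw [Finset.sum_comm]
    refine Finset.sum_eq_zero fun x _ => ?_
    simp only [← mul_assoc, ← Finset.sum_mul, ← map_mul, ← map_sum]
    have := congrFun hc x
    simp only [Finset.sum_apply, Pi.smul_apply, smul_eq_mul, Pi.zero_apply] at this
    rw [this, map_zero, zero_mul, zero_mul]
  have := congrArg diagonal hzero
  rw [diagonal_sum, diagonal_zero] at this
  simp only [diagonal_aeval_mul hn] at this
  exact this

end Rank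

/-! ### From finite rank and Frobenius to a linear relation. -/

section Frobenius

/-- A basis `b ⊆ G` of the span of `G` has at most `N` elements. For `l ≤ N`, iterating `hG` lifts
`g ^ p ^ l` to the common level of `p ^ N`-th powers of `G`, all of which lie in the span of the at
most `N` powers of `b`. -/
theorem not_linearIndependent_pow_of_field {F L : Type*} [Field F] [Field L] [Algebra F L] (p : ℕ)
    [Fact p.Prime] [CharP L p] {G : Set L} {N : ℕ}
    (hN : ∀ v : Fin (N + 1) → L, (∀ i, v i ∈ G) → ¬ LinearIndependent F v)
    (hG : ∀ v ∈ G, v ∈ Submodule.span F ((· ^ p) '' G)) {g : L} (hg : g ∈ G) :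
    ¬ LinearIndependent F fun l : Fin (N + 1) => g ^ p ^ (l : ℕ) := by
  obtain ⟨b, hbG, hspan, hli⟩ := exists_linearIndependent F G
  have hcard : b.encard ≤ N := by
    by_contra! h
    obtain ⟨t, htb, ht⟩ := Set.exists_subset_encard_eq (k := ((N + 1 : ℕ) : ℕ∞)) (s := b)
      (by push_cast; exact Order.add_one_le_of_lt h)
    have htf : t.Finite := Set.finite_of_encard_eq_coe ht
    have htc : Nat.card t = N + 1 := by
      rw [Nat.card_coe_set_eq, Set.ncard, ht]; rfl
    have : Finite t := htf
    obtain ⟨e⟩ := Finite.card_eq.1 (by rw [Nat.card_fin, htc] : Nat.card (Fin (N + 1)) = Nat.card t)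
    refine hN (fun i => (e i : L)) (fun i => hbG (htb (e i).2)) ?_
    have hlt : LinearIndependent F ((↑) : t → L) := LinearIndepOn.mono (v := id) hli htb
    exact hlt.comp e e.injective
  have hbfin : b.Finite := Set.finite_of_encard_le_coe hcard
  have hpow : ∀ j, ∀ v ∈ Submodule.span F G, v ^ p ^ j ∈ Submodule.span F ((· ^ p ^ j) '' b) := by
    intro j v hv
    rw [← hspan] at hv
    induction hv using Submodule.span_induction with
    | mem x hx => exact Submodule.subset_span ⟨x, hx, rfl⟩
    | zero =>
      rw [zero_pow (pow_ne_zero _ (Fact.out : p.Prime).ne_zero)]; exact zero_mem _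
    | add x y _ _ hx hy => rw [add_pow_char_pow]; exact add_mem hx hy
    | smul a x _ hx => rw [smul_pow]; exact Submodule.smul_mem _ _ hx
  have hstep : ∀ l, ∀ v ∈ Submodule.span F ((· ^ p ^ l) '' G),
      v ∈ Submodule.span F ((· ^ p ^ (l + 1)) '' G) := by
    intro l v hv
    refine Submodule.span_le.2 ?_ hv
    rintro _ ⟨x, hx, rfl⟩
    have hxs := hG x hx
    clear hx
    simp only [SetLike.mem_coe]
    induction hxs using Submodule.span_induction with
    | mem x hx =>
      obtain ⟨y, hy, rfl⟩ := hx
      refine Submodule.subset_span ⟨y, hy, ?_⟩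
      simp only
      rw [← pow_mul, pow_succ']
    | zero =>
      rw [zero_pow (pow_ne_zero _ (Fact.out : p.Prime).ne_zero)]; exact zero_mem _
    | add x y _ _ hx hy => rw [add_pow_char_pow]; exact add_mem hx hy
    | smul a x _ hx => rw [smul_pow]; exact Submodule.smul_mem _ _ hx
  have hmem : ∀ j l, ∀ v ∈ Submodule.span F ((· ^ p ^ l) '' G),
      v ∈ Submodule.span F ((· ^ p ^ (l + j)) '' G) := by
    intro j
    induction j with
    | zero => intro l v hv; exact hv
    | succ j ih => intro l v hv; exact hstep _ _ (ih l v hv)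
  have hle : Submodule.span F ((· ^ p ^ N) '' G) ≤ Submodule.span F ((· ^ p ^ N) '' b) := by
    rw [Submodule.span_le]
    rintro _ ⟨x, hx, rfl⟩
    exact hpow N x (Submodule.subset_span hx)
  intro hind
  have hrange : Set.range (fun l : Fin (N + 1) => g ^ p ^ (l : ℕ)) ⊆
      Submodule.span F ((· ^ p ^ N) '' b) := by
    rintro _ ⟨l, rfl⟩
    apply hle
    have := hmem (N - l) l (g ^ p ^ (l : ℕ)) (Submodule.subset_span ⟨g, hg, rfl⟩)
    rwa [Nat.add_sub_cancel' (Nat.lt_succ_iff.1 l.2)] at this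
  have hfin : ((· ^ p ^ N) '' b).Finite := hbfin.image _
  let _ := hfin.fintype
  have h1 := linearIndependent_le_span' _ hind _ hrange
  have h2 : Fintype.card ((· ^ p ^ N) '' b) ≤ N := by
    rw [← Nat.card_eq_fintype_card, Nat.card_coe_set_eq]
    refine (Set.ncard_image_le hbfin).trans ?_
    rw [← hbfin.cast_ncard_eq] at hcard
    exact_mod_cast hcard
  rw [Cardinal.mk_fin] at h1
  have h3 := Nat.cast_le.1 h1
  omega

theorem not_linearIndependent_pow {R S : Type*} [CommRing R] [IsDomain R] [CommRing S] [IsDomain S]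
    [Algebra R S] [FaithfulSMul R S] (p : ℕ) [Fact p.Prime] [CharP S p] {G : Set S} {N : ℕ}
    (hN : ∀ v : Fin (N + 1) → S, (∀ i, v i ∈ G) → ¬ LinearIndependent R v)
    (hG : ∀ v ∈ G, v ∈ Submodule.span R ((· ^ p) '' G)) {g : S} (hg : g ∈ G) :
    ¬ LinearIndependent R fun l : Fin (N + 1) => g ^ p ^ (l : ℕ) := by
  let L := FractionRing S
  let F := FractionRing R
  have : FaithfulSMul R L := (faithfulSMul_iff_algebraMap_injective R L).2 (by
    rw [IsScalarTower.algebraMap_eq R S L]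
    exact (IsFractionRing.injective S L).comp (FaithfulSMul.algebraMap_injective R S))
  let _ : Algebra F L := FractionRing.liftAlgebra R L
  have : IsScalarTower R F L := FractionRing.isScalarTower_liftAlgebra R L
  have : CharP L p := charP_of_injective_algebraMap (IsFractionRing.injective S L) p
  let φ : S →ₗ[R] L := (IsScalarTower.toAlgHom R S L).toLinearMap
  have hφ : Function.Injective φ := IsFractionRing.injective S L
  have hφpow : ∀ x : S, ∀ m, φ (x ^ m) = φ x ^ m := fun x m => map_pow (algebraMap S L) x m
  have key := not_linearIndependent_pow_of_field (F := F) (L := L) p (G := φ '' G) (N := N) ?_ ?_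
    (Set.mem_image_of_mem φ hg)
  · intro h
    apply key
    rw [← LinearIndependent.iff_fractionRing R F]
    simp only [← hφpow]
    exact h.map' φ (LinearMap.ker_eq_bot.2 hφ)
  · intro v hv h
    choose u hu huv using hv
    refine hN u hu (LinearIndependent.of_comp φ ?_)
    rw [LinearIndependent.iff_fractionRing R F]
    exact (funext huv : φ ∘ u = v) ▸ h
  · rintro _ ⟨v, hv, rfl⟩
    have h1 := Submodule.mem_map_of_mem (f := φ) (hG v hv)
    rw [Submodule.map_span, Set.image_image] at h1
    have h2 := Submodule.span_le_restrictScalars R F _ h1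
    rw [Set.image_image]
    simp only [hφpow] at h2
    exact h2

end Frobenius

/-! ### Counting the admissible exponents with a zero entry. -/

section Counting

variable {n : ℕ}

/-- The exponents of total degree at most `h`. -/
noncomputable def simplexExp (n h : ℕ) : Finset (Fin n →₀ ℕ) :=
  (Finset.range (h + 1)).biUnion fun j => Finset.univ.finsuppAntidiag j

theorem mem_simplexExp {h : ℕ} {m : Fin n →₀ ℕ} : m ∈ simplexExp n h ↔ ∑ i, m i ≤ h := by
  simp [simplexExp]

theorem card_simplexExp (n h : ℕ) : (simplexExp n h).card = (n + h).choose n := by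
  have hc : ∀ h, ∑ j ∈ Finset.range (h + 1), n.multichoose j = (n + 1).multichoose h := by
    intro h
    induction h with
    | zero => simp
    | succ h ih => rw [Finset.sum_range_succ, ih, Nat.multichoose_succ_succ, add_comm]
  rw [simplexExp, Finset.card_biUnion]
  · simp only [Finset.card_finsuppAntidiag_nat_eq_multichoose, Finset.card_univ, Fintype.card_fin]
    rw [hc, Nat.multichoose_eq, Nat.add_right_comm, Nat.add_sub_cancel]
    exact Nat.choose_symm_add.symm
  · intro a _ b _ hab
    rw [Function.onFun, Finset.disjoint_left]
    intro m hm hm'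
    simp only [Finset.mem_finsuppAntidiag] at hm hm'
    exact hab (hm.1.symm.trans hm'.1)

/-- The exponents bounded by `hs`, of total degree at most `h`, with at least one zero entry. -/
noncomputable def boundaryExp (hs : Fin n → ℕ) (h : ℕ) : Finset (Fin n →₀ ℕ) :=
  (simplexExp n h).filter fun m => (∀ i, m i ≤ hs i) ∧ ∃ i, m i = 0

theorem mem_boundaryExp {hs : Fin n → ℕ} {h : ℕ} {m : Fin n →₀ ℕ} :
    m ∈ boundaryExp hs h ↔ ∑ i, m i ≤ h ∧ (∀ i, m i ≤ hs i) ∧ ∃ i, m i = 0 := by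
  rw [boundaryExp, Finset.mem_filter, mem_simplexExp]

theorem card_boundaryExp_le_box (hs : Fin n → ℕ) (h : ℕ) :
    (boundaryExp hs h).card ≤ (∏ i, (hs i + 1)) - ∏ i, hs i := by
  classical
  have hsub : Fintype.piFinset (fun i => Finset.Icc 1 (hs i)) ⊆
      Fintype.piFinset fun i => Finset.range (hs i + 1) := by
    refine Fintype.piFinset_subset _ _ fun i x hx => ?_
    rw [Finset.mem_Icc] at hx
    rw [Finset.mem_range]
    omega
  have hcard := Finset.card_sdiff_of_subset hsub
  simp only [Fintype.card_piFinset, Finset.card_range, Nat.card_Icc, Nat.add_sub_cancel] at hcard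
  rw [← hcard]
  refine Finset.card_le_card_of_injOn (fun m => ⇑m) ?_ fun a _ b _ hab => DFunLike.coe_injective hab
  intro m hm
  obtain ⟨-, hb, i, hi⟩ := mem_boundaryExp.1 hm
  simp only [Finset.mem_coe, Finset.mem_sdiff, Fintype.mem_piFinset, Finset.mem_range,
    Finset.mem_Icc, not_forall]
  exact ⟨fun j => Nat.lt_succ_of_le (hb j), i, fun h => by omega⟩

/-- The simplex exponents without zero entry are the translates by `(1, …, 1)` of the simplex of
size `h - n`. If `h < n` there are none, and `h.choose n` vanishes. -/
theorem card_boundaryExp_le_simplex (hs : Fin n → ℕ) (h : ℕ) :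
    (boundaryExp hs h).card ≤ (n + h).choose n - h.choose n := by
  classical
  by_cases hnh : n ≤ h
  · have hinj : Set.InjOn (fun m => m + diagExp n 1) (simplexExp n (h - n)) :=
      fun a _ b _ hab => add_right_cancel hab
    have hsub : (simplexExp n (h - n)).image (fun m => m + diagExp n 1) ⊆ simplexExp n h := by
      intro m hm
      obtain ⟨a, ha, rfl⟩ := Finset.mem_image.1 hm
      rw [mem_simplexExp] at ha ⊢
      simp only [Finsupp.add_apply, diagExp_apply, Finset.sum_add_distrib, Finset.sum_const,
        Finset.card_univ, Fintype.card_fin, smul_eq_mul, mul_one]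
      omega
    have hcard := Finset.card_sdiff_of_subset hsub
    rw [Finset.card_image_of_injOn hinj, card_simplexExp, card_simplexExp,
      Nat.add_sub_cancel' hnh] at hcard
    rw [← hcard]
    refine Finset.card_le_card fun m hm => ?_
    obtain ⟨ht, -, i, hi⟩ := mem_boundaryExp.1 hm
    rw [Finset.mem_sdiff, mem_simplexExp]
    refine ⟨ht, fun h' => ?_⟩
    obtain ⟨a, -, rfl⟩ := Finset.mem_image.1 h'
    simp at hi
  · rw [Nat.choose_eq_zero_of_lt (not_le.1 hnh), Nat.sub_zero, ← card_simplexExp]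
    exact Finset.card_filter_le _ _

/-- Subtract the smallest entry from all entries. -/
theorem exists_boundaryExp_add_diagExp (hn : 1 ≤ n) {hs : Fin n → ℕ} {h : ℕ} {m : Fin n →₀ ℕ}
    (hm : ∑ i, m i ≤ h) (hm' : ∀ i, m i ≤ hs i) :
    ∃ e ∈ boundaryExp hs h, ∃ s, m = e + diagExp n s := by
  have : Nonempty (Fin n) := ⟨⟨0, hn⟩⟩
  obtain ⟨i, hi⟩ := Finite.exists_min m
  have hle : diagExp n (m i) ≤ m := hi
  refine ⟨m - diagExp n (m i), ?_, m i, (tsub_add_cancel_of_le hle).symm⟩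
  rw [mem_boundaryExp]
  refine ⟨(Finset.sum_le_sum fun j _ => ?_).trans hm, fun j => le_trans ?_ (hm' j), i, ?_⟩
  · simp
  · simp
  · simp

end Counting

instance faithfulSMul_powerSeries {K : Type*} [Field K] :
    FaithfulSMul (Polynomial K) (PowerSeries K) := by
  rw [faithfulSMul_iff_algebraMap_injective]
  intro a b hab
  simpa [PowerSeries.algebraMap_apply'] using hab

instance faithfulSMul_mvPowerSeries {σ K : Type*} [Field K] :
    FaithfulSMul (MvPolynomial σ K) (MvPowerSeries σ K) := by
  rw [faithfulSMul_iff_algebraMap_injective]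
  intro a b hab
  simpa [MvPowerSeries.algebraMap_apply'] using hab

theorem not_linearIndependent_diagonal_pow {K : Type*} [Field K] (p : ℕ) [Fact p.Prime] [CharP K p]
    [PerfectRing K p] {n : ℕ} (hn : 1 ≤ n) {A : Polynomial (MvPowerSeries (Fin n) K)}
    {f : MvPowerSeries (Fin n) K} {d h : ℕ} {hs : Fin n → ℕ} (hd : A.natDegree ≤ d)
    (hA : ∀ j m, MvPowerSeries.coeff m (A.coeff j) ≠ 0 → (∀ i, m i ≤ hs i) ∧ ∑ i, m i ≤ h)
    (hf : A.eval f = 0) (hD : A.derivative.eval f ≠ 0) :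
    ¬ LinearIndependent (Polynomial K)
      fun l : Fin (d * (boundaryExp hs h).card + 1) => diagonal f ^ p ^ (l : ℕ) := by
  have hp : 0 < p := (Fact.out : p.Prime).pos
  -- `E a` bounds a product of `a` factors with the height bounds of `A`; a section divides
  -- exponents by `p` and so maps `E p` back to `E 1`.
  let E : ℕ → Set (Fin n →₀ ℕ) := fun a => {m | (∀ i, m i ≤ a * hs i) ∧ ∑ i, m i ≤ a * h}
  have hE0 : 0 ∈ E 0 := by simp [E]
  have hEadd : ∀ a b, ∀ x ∈ E a, ∀ y ∈ E b, x + y ∈ E (a + b) := by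
    rintro a b x ⟨hx, hx'⟩ y ⟨hy, hy'⟩
    refine ⟨fun i => ?_, ?_⟩
    · rw [add_mul]; exact add_le_add (hx i) (hy i)
    · simp only [Finsupp.add_apply, Finset.sum_add_distrib]
      rw [add_mul]; exact add_le_add hx' hy'
  have hEr : ∀ r i, r + p • i ∈ E p → i ∈ E 1 := by
    rintro r m ⟨h1, h2⟩
    refine ⟨fun i => ?_, ?_⟩
    · have := h1 i
      simp only [Finsupp.add_apply, Finsupp.smul_apply, smul_eq_mul] at this
      rw [one_mul]
      exact Nat.le_of_mul_le_mul_left (le_trans (Nat.le_add_left _ _) this) hp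
    · simp only [Finsupp.add_apply, Finsupp.smul_apply, smul_eq_mul, Finset.sum_add_distrib,
        ← Finset.mul_sum] at h2
      rw [one_mul]
      exact Nat.le_of_mul_le_mul_left (le_trans (Nat.le_add_left _ _) h2) hp
  have hAE : ∀ j, A.coeff j ∈ suppIn K (E 1) := fun j m hm => by
    simpa [E] using hA j m hm
  have hfin : (E 1).Finite := by
    refine (simplexExp n h).finite_toSet.subset fun m hm => ?_
    rw [Finset.mem_coe, mem_simplexExp, ← one_mul h]
    exact hm.2
  have hchar : CharP (PowerSeries K) p :=
    charP_of_injective_algebraMap (algebraMap K (PowerSeries K)).injective p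
  refine not_linearIndependent_pow p (G := diagonal '' quotientsIn A f d (E 1)) ?_ ?_
    ⟨f, self_mem_quotientsIn hAE hd hf, rfl⟩
  · intro v hv
    choose w hw hwv using hv
    rw [← funext hwv]
    refine not_linearIndependent_diagonal hn hfin _ (fun m hm => ?_) hD w hw
    refine exists_boundaryExp_add_diagExp hn ?_ fun i => ?_
    · simpa using hm.2
    · simpa using hm.1 i
  · rintro _ ⟨w, hw, rfl⟩
    rw [diagonal_eq_sum_cartier p w]
    refine sum_mem fun s hs => ?_
    have : (PowerSeries.X : PowerSeries K) ^ s * diagonal (cartier p (diagExp n s) w) ^ p =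
        (Polynomial.X ^ s : Polynomial K) • diagonal (cartier p (diagExp n s) w) ^ p := by
      rw [Algebra.smul_def]; simp [PowerSeries.algebraMap_apply']
    rw [this]
    refine Submodule.smul_mem _ _ (Submodule.subset_span ⟨_, ⟨_, ?_, rfl⟩, rfl⟩)
    exact cartier_mem_quotientsIn p hE0 hEadd (fun _ => Finset.mem_range.1 hs) (hEr _) hAE hd hf hw

open Polynomial

/-! ### A minimal annihilator and the heights of its multiples. -/

section MinimalAnnihilator

/-- The annihilators form a prime ideal, so some prime factor of an annihilator of least degree lies
in it. Divisibility follows by pseudo-division, as an induction on the degree of `B`. -/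
theorem exists_prime_annihilator {R S : Type*} [CommRing R] [IsDomain R]
    [UniqueFactorizationMonoid R] [CommRing S] [IsDomain S] [Algebra R S] [FaithfulSMul R S] {f : S}
    (hf : IsAlgebraic R f) :
    ∃ A : R[X], A ≠ 0 ∧ aeval f A = 0 ∧
      (∀ B : R[X], B ≠ 0 → aeval f B = 0 → A.natDegree ≤ B.natDegree) ∧
      ∀ B : R[X], aeval f B = 0 → A ∣ B := by
  classical
  have hex : ∃ m, ∃ A : R[X], A ≠ 0 ∧ aeval f A = 0 ∧ A.natDegree = m := by
    obtain ⟨A, hA, hA'⟩ := hf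
    exact ⟨_, A, hA, hA', rfl⟩
  obtain ⟨A₁, hA₁, hA₁f, hA₁d⟩ := Nat.find_spec hex
  have hmin : ∀ B : R[X], B ≠ 0 → aeval f B = 0 → Nat.find hex ≤ B.natDegree :=
    fun B hB hBf => Nat.find_min' hex ⟨B, hB, hBf, rfl⟩
  have hprime : (RingHom.ker (aeval (R := R) f)).IsPrime := RingHom.ker_isPrime _
  obtain ⟨u, hu⟩ := UniqueFactorizationMonoid.factors_prod hA₁
  have hmem : (UniqueFactorizationMonoid.factors A₁).prod ∈ RingHom.ker (aeval (R := R) f) := by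
    rw [← Ideal.mul_unit_mem_iff_mem _ u.isUnit, hu]; exact hA₁f
  obtain ⟨A, hAmem, hAf⟩ := (hprime.multiset_prod_mem_iff_exists_mem _).1 hmem
  have hAp : Prime A := UniqueFactorizationMonoid.prime_of_factor A hAmem
  have hAd : A.natDegree ≤ Nat.find hex := by
    rw [← hA₁d]
    exact natDegree_le_of_dvd (UniqueFactorizationMonoid.dvd_of_mem_factors hAmem) hA₁
  have hAf' : aeval f A = 0 := hAf
  have hpos : 0 < A.natDegree := by
    rw [Nat.pos_iff_ne_zero]
    intro h0
    rw [natDegree_eq_zero] at h0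
    obtain ⟨c, rfl⟩ := h0
    rw [aeval_C, FaithfulSMul.algebraMap_eq_zero_iff] at hAf'
    exact hAp.ne_zero (by rw [hAf', C_0])
  refine ⟨A, hAp.ne_zero, hAf', fun B hB hBf => hAd.trans (hmin B hB hBf), ?_⟩
  suffices h : ∀ m, ∀ B : R[X], B.natDegree = m → aeval f B = 0 → A ∣ B from
    fun B => h _ B rfl
  intro m
  induction m using Nat.strong_induction_on with
  | _ m ih =>
    intro B hBm hBf
    by_cases hB : B = 0
    · rw [hB]; exact dvd_zero _
    have hle : A.natDegree ≤ B.natDegree := hAd.trans (hmin B hB hBf)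
    have hlt := natDegree_cancelLeads_lt_of_natDegree_le_natDegree hle (hpos.trans_le hle)
    have hdvd := ih _ (hBm ▸ hlt) (A.cancelLeads B) rfl (by
      simp [cancelLeads, hBf, hAf'])
    rw [cancelLeads, Nat.sub_eq_zero_of_le hle, pow_zero, mul_one,
      dvd_sub_left (dvd_mul_left _ _)] at hdvd
    -- Here `A` divides its leading coefficient times `B`, and a prime of positive degree cannot
    -- divide a nonzero constant.
    refine (hAp.dvd_or_dvd hdvd).resolve_left fun h => ?_
    have := natDegree_le_of_dvd h (by simpa using hAp.ne_zero)
    rw [natDegree_C] at this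
    omega

/-- As in Gauss's lemma: take the last coefficients of `A` and of `B` where `δ` is maximal. Their
product strictly dominates every other term of the same coefficient of `A * B`, so nothing cancels
it. -/
theorem le_of_coeff_mul_le {R : Type*} [CommRing R] [IsDomain R] (δ : R → ℕ)
    (h0 : δ 0 = 0) (hmul : ∀ a b, a ≠ 0 → b ≠ 0 → δ (a * b) = δ a + δ b)
    (hsub : ∀ a b, δ (a - b) ≤ max (δ a) (δ b)) {A B : R[X]} (hB : B ≠ 0) {H : ℕ}
    (hAB : ∀ j, δ ((A * B).coeff j) ≤ H) (j : ℕ) : δ (A.coeff j) ≤ H := by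
  classical
  by_contra! hj
  let F : ℕ → AddSubgroup R := fun t => AddSubgroup.ofSub {a | δ a < t + 1} ⟨0, by simp [h0]⟩
    fun x hx y hy => by
      simp only [Set.mem_ofPred_eq] at hx hy ⊢
      exact (sub_eq_add_neg x y) ▸ (hsub x y).trans_lt (max_lt hx hy)
  have hF : ∀ t a, a ∈ F t ↔ δ a < t + 1 := fun t a => Iff.rfl
  have hlast : ∀ P : R[X], P ≠ 0 → ∃ i, P.coeff i ≠ 0 ∧ (∀ l, δ (P.coeff l) ≤ δ (P.coeff i)) ∧
      ∀ l, i < l → P.coeff l ≠ 0 → δ (P.coeff l) < δ (P.coeff i) := by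
    intro P hP
    obtain ⟨i₀, hi₀, hmax⟩ := P.support.exists_max_image (fun i => δ (P.coeff i))
      (nonempty_support_iff.2 hP)
    let T := P.support.filter fun i => δ (P.coeff i) = δ (P.coeff i₀)
    obtain ⟨i, hi, hmax'⟩ := T.exists_max_image id ⟨i₀, by simp [T, mem_support_iff.1 hi₀]⟩
    simp only [T, Finset.mem_filter, mem_support_iff, id] at hi hmax'
    refine ⟨i, hi.1, fun l => ?_, fun l hl hl' => ?_⟩
    · rw [hi.2]
      by_cases hl : P.coeff l = 0
      · simp [hl, h0]
      · exact hmax l (mem_support_iff.2 hl)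
    · rw [hi.2]
      refine lt_of_le_of_ne (hmax l (mem_support_iff.2 hl')) fun h => ?_
      have := hmax' l ⟨hl', h⟩
      omega
  have hA : A ≠ 0 := by
    rintro rfl
    simp [h0] at hj
  obtain ⟨i₀, hi₀, hmaxA, hltA⟩ := hlast A hA
  obtain ⟨j₀, hj₀, hmaxB, hltB⟩ := hlast B hB
  have hM : H < δ (A.coeff i₀) := hj.trans_le (hmaxA j)
  obtain ⟨t, ht⟩ : ∃ t, δ (A.coeff i₀) + δ (B.coeff j₀) = t + 1 := ⟨_, (Nat.sub_add_cancel
    (by omega : 1 ≤ δ (A.coeff i₀) + δ (B.coeff j₀))).symm⟩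
  have hc : (A * B).coeff (i₀ + j₀) ∈ F t := by
    rw [hF]
    have := hAB (i₀ + j₀)
    omega
  have hmem : (i₀, j₀) ∈ Finset.HasAntidiagonal.antidiagonal (i₀ + j₀) := by simp
  rw [coeff_mul, ← Finset.add_sum_erase _ _ hmem] at hc
  have hrest : ∑ x ∈ (Finset.HasAntidiagonal.antidiagonal (i₀ + j₀)).erase (i₀, j₀), A.coeff x.1 * B.coeff x.2 ∈
      F t := by
    refine sum_mem fun x hx => ?_
    rw [Finset.mem_erase, Finset.HasAntidiagonal.mem_antidiagonal] at hx
    obtain ⟨hne, hx⟩ := hx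
    by_cases ha : A.coeff x.1 = 0
    · rw [ha, zero_mul]; exact zero_mem _
    by_cases hb : B.coeff x.2 = 0
    · rw [hb, mul_zero]; exact zero_mem _
    rw [hF, hmul _ _ ha hb, ← ht]
    rcases lt_trichotomy x.1 i₀ with h | h | h
    · exact add_lt_add_of_le_of_lt (hmaxA _) (hltB _ (by omega) hb)
    · exact absurd (Prod.ext h (by simp only; omega)) hne
    · exact add_lt_add_of_lt_of_le (hltA _ h ha) (hmaxB _)
  have := (F t).sub_mem hc hrest
  rw [add_sub_cancel_right, hF, hmul _ _ hi₀ hj₀, ht] at this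
  exact lt_irrefl _ this

end MinimalAnnihilator

/-! ### Separability of the minimal annihilator over a perfect field. -/

section Separable

variable {σ K : Type*} [Field K] (p : ℕ) [Fact p.Prime] [CharP K p] [PerfectRing K p]

theorem exists_coe_eq_cartier (r : σ →₀ ℕ) (b : MvPolynomial σ K) :
    ∃ c : MvPolynomial σ K, (c : MvPowerSeries σ K) = cartier p r (b : MvPowerSeries σ K) := by
  have hp : p ≠ 0 := (Fact.out : p.Prime).ne_zero
  have hinj : Function.Injective fun m : σ →₀ ℕ => r + p • m := fun x y h =>
    smul_right_injective (σ →₀ ℕ) hp (add_left_cancel h)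
  have hfin : {m : σ →₀ ℕ | MvPowerSeries.coeff m (cartier p r (b : MvPowerSeries σ K)) ≠ 0}.Finite := by
    refine (b.support.finite_toSet.preimage hinj.injOn).subset fun m hm => ?_
    simp only [Set.mem_preimage, Finset.mem_coe, MvPolynomial.mem_support_iff]
    intro h
    apply hm
    rw [coeff_cartier, MvPolynomial.coeff_coe, h, map_zero]
  classical
  refine ⟨∑ m ∈ hfin.toFinset, MvPolynomial.monomial m (MvPowerSeries.coeff m (cartier p r (b : MvPowerSeries σ K))), ?_⟩
  ext m
  rw [MvPolynomial.coeff_coe, MvPolynomial.coeff_sum]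
  simp only [MvPolynomial.coeff_monomial, Finset.sum_ite_eq', Set.Finite.mem_toFinset,
    Set.mem_ofPred_eq]
  split_ifs with h
  · rfl
  · exact (not_not.1 h).symm

/-- Otherwise minimality gives `A' = 0`, so `A = B(y^p)`. A section turns `∑ bⱼ f^(pj) = 0` into `∑
Λᵣ(bⱼ) f^j = 0`, an annihilator of smaller degree. -/
theorem aeval_derivative_ne_zero {σ K : Type*} [Field K] (p : ℕ) [Fact p.Prime] [CharP K p]
    [PerfectRing K p] {f : MvPowerSeries σ K} {A : (MvPolynomial σ K)[X]} (hA : A ≠ 0)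
    (hf : aeval f A = 0)
    (hmin : ∀ B : (MvPolynomial σ K)[X], B ≠ 0 → aeval f B = 0 → A.natDegree ≤ B.natDegree) :
    aeval f A.derivative ≠ 0 := by
  have hp : p.Prime := Fact.out
  have : CharP (MvPolynomial σ K) p :=
    charP_of_injective_algebraMap (algebraMap K (MvPolynomial σ K)).injective p
  have hpos : 0 < A.natDegree := by
    rw [Nat.pos_iff_ne_zero]
    intro h
    rw [natDegree_eq_zero] at h
    obtain ⟨c, rfl⟩ := h
    rw [aeval_C, FaithfulSMul.algebraMap_eq_zero_iff] at hf
    exact hA (by rw [hf, C_0])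
  intro hd
  have hd0 : A.derivative = 0 := by
    by_contra h
    have := hmin _ h hd
    have := natDegree_derivative_lt hpos.ne'
    omega
  have hexp : expand _ p (contract p A) = A := expand_contract p hd0 hp.ne_zero
  set B := contract p A with hB
  have hBd : B.natDegree * p = A.natDegree := by rw [← hexp, natDegree_expand]
  have hB0 : B ≠ 0 := by rintro h; rw [h] at hexp; exact hA (by rw [← hexp, map_zero])
  have hBlt : B.natDegree < A.natDegree := by
    rw [← hBd] at hpos ⊢
    have := Nat.pos_of_mul_pos_right hpos
    nlinarith [hp.two_le]
  obtain ⟨j₀, hj₀⟩ : ∃ j, B.coeff j ≠ 0 := by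
    by_contra! h; exact hB0 (ext h)
  obtain ⟨m₀, hm₀⟩ : ∃ m, MvPolynomial.coeff m (B.coeff j₀) ≠ 0 := by
    by_contra! h; exact hj₀ (MvPolynomial.ext _ _ h)
  -- The residue of an exponent occurring in `B`, so that the section of `B` does not vanish.
  let r : σ →₀ ℕ := m₀.mapRange (· % p) (Nat.zero_mod p)
  have hr : ∀ i, r i < p := fun i => Nat.mod_lt _ hp.pos
  choose c hc using fun j => exists_coe_eq_cartier p r (B.coeff j)
  let Q : (MvPolynomial σ K)[X] := ∑ j ∈ Finset.range (B.natDegree + 1), monomial j (c j)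
  have hQcoeff : ∀ j ≤ B.natDegree, Q.coeff j = c j := by
    intro j hj
    simp only [Q, finsetSum_coeff, coeff_monomial, Finset.sum_ite_eq', Finset.mem_range]
    rw [if_pos (Nat.lt_succ_of_le hj)]
  have hQ0 : Q ≠ 0 := by
    intro h
    have h1 := hQcoeff j₀ (le_natDegree_of_ne_zero hj₀)
    have h2 := hc j₀
    rw [← h1, h, coeff_zero, MvPolynomial.coe_zero] at h2
    have h3 := congrArg (MvPowerSeries.coeff (m₀.mapRange (· / p) (Nat.zero_div p))) h2
    have h4 := coeff_cartier_pow p r (B.coeff j₀ : MvPowerSeries σ K)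
      (m₀.mapRange (· / p) (Nat.zero_div p))
    have h5 : r + p • m₀.mapRange (· / p) (Nat.zero_div p) = m₀ :=
      Finsupp.ext fun i => Nat.mod_add_div _ _
    rw [← h3, map_zero, zero_pow hp.ne_zero, h5, MvPolynomial.coeff_coe] at h4
    exact hm₀ h4.symm
  have hQd : Q.natDegree ≤ B.natDegree :=
    natDegree_sum_le_of_forall_le _ _ fun j hj =>
      (natDegree_monomial_le _).trans (Nat.lt_succ_iff.1 (Finset.mem_range.1 hj))
  have hQf : aeval f Q = 0 := by
    have h1 : aeval f A = ∑ j ∈ Finset.range (B.natDegree + 1),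
        (f ^ j) ^ p * (B.coeff j : MvPowerSeries σ K) := by
      rw [← hexp, expand_aeval, aeval_eq_sum_range]
      refine Finset.sum_congr rfl fun j _ => ?_
      rw [Algebra.smul_def, mul_comm, ← pow_mul, ← pow_mul, mul_comm p]
      rfl
    have h2 := congrArg (cartier p r) (h1.symm.trans hf)
    rw [map_sum, map_zero] at h2
    rw [← h2, map_sum]
    refine Finset.sum_congr rfl fun j _ => ?_
    rw [aeval_monomial, cartier_pow_mul p hr, ← hc, mul_comm]
    rfl
  have := hmin Q hQ0 hQf
  omega

end Separable

theorem totalDegree_coeff_le_of_mul {σ K : Type*} [Field K] {A C : (MvPolynomial σ K)[X]}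
    (hC : C ≠ 0) {h : ℕ} (hAC : ∀ j, ((A * C).coeff j).totalDegree ≤ h) (j : ℕ) :
    (A.coeff j).totalDegree ≤ h := by
  refine le_of_coeff_mul_le (R := MvPolynomial σ K) MvPolynomial.totalDegree
    MvPolynomial.totalDegree_zero
    (fun a b ha hb => ?_) (fun a b => ?_) hC hAC j
  · rw [MvPolynomial.totalDegree_mul_of_isDomain ha hb]
  · exact MvPolynomial.totalDegree_sub a b

theorem degreeOf_coeff_le_of_mul {σ K : Type*} [Field K] (i : σ) {A C : (MvPolynomial σ K)[X]}
    (hC : C ≠ 0) {h : ℕ} (hAC : ∀ j, ((A * C).coeff j).degreeOf i ≤ h) (j : ℕ) :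
    (A.coeff j).degreeOf i ≤ h := by
  refine le_of_coeff_mul_le (R := MvPolynomial σ K) (MvPolynomial.degreeOf i) (MvPolynomial.degreeOf_zero i)
    (fun a b ha hb => ?_) (fun a b => ?_) hC hAC j
  · rw [MvPolynomial.degreeOf_mul_eq ha hb]
  · exact MvPolynomial.degreeOf_sub_le i a b

theorem not_linearIndependent_diagonal_pow_of_annihilators {K : Type*} [Field K] (p : ℕ)
    [Fact p.Prime] [CharP K p] [PerfectRing K p] {n : ℕ} (hn : 1 ≤ n) {f : MvPowerSeries (Fin n) K}
    {d h : ℕ} {hs : Fin n → ℕ}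
    (hd : ∃ B : (MvPolynomial (Fin n) K)[X], B ≠ 0 ∧ aeval f B = 0 ∧ B.natDegree ≤ d)
    (hh : ∃ B : (MvPolynomial (Fin n) K)[X], B ≠ 0 ∧ aeval f B = 0 ∧
      ∀ j, (B.coeff j).totalDegree ≤ h)
    (hhs : ∀ i, ∃ B : (MvPolynomial (Fin n) K)[X], B ≠ 0 ∧ aeval f B = 0 ∧
      ∀ j, (B.coeff j).degreeOf i ≤ hs i) :
    ¬ LinearIndependent K[X]
      fun l : Fin (d * (boundaryExp hs h).card + 1) => diagonal f ^ p ^ (l : ℕ) := by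
  have : IsDomain (MvPowerSeries (Fin n) K) := NoZeroDivisors.to_isDomain _
  obtain ⟨B, hB, hBf, hBd⟩ := hd
  obtain ⟨A, hA, hAf, hmin, hdvd⟩ :=
    exists_prime_annihilator (R := MvPolynomial (Fin n) K) (f := f) ⟨B, hB, hBf⟩
  have htot : ∀ j, (A.coeff j).totalDegree ≤ h := by
    obtain ⟨B, hB, hBf, hBh⟩ := hh
    obtain ⟨C, hC⟩ := hdvd B hBf
    rw [hC] at hB hBh
    exact totalDegree_coeff_le_of_mul (right_ne_zero_of_mul hB) hBh
  have hdeg : ∀ i j, (A.coeff j).degreeOf i ≤ hs i := by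
    intro i
    obtain ⟨B, hB, hBf, hBh⟩ := hhs i
    obtain ⟨C, hC⟩ := hdvd B hBf
    rw [hC] at hB hBh
    exact degreeOf_coeff_le_of_mul i (right_ne_zero_of_mul hB) hBh
  refine not_linearIndependent_diagonal_pow p hn
    (A := A.map (algebraMap (MvPolynomial (Fin n) K) (MvPowerSeries (Fin n) K))) ?_ ?_ ?_ ?_
  · exact natDegree_map_le.trans ((hmin B hB hBf).trans hBd)
  · intro j m hm
    rw [coeff_map] at hm
    have hm' : m ∈ (A.coeff j).support := by
      rw [MvPolynomial.mem_support_iff]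
      simpa [MvPowerSeries.algebraMap_apply'] using hm
    refine ⟨fun i => (MvPolynomial.le_degreeOf_of_mem_support i hm').trans (hdeg i j), ?_⟩
    have := MvPolynomial.le_totalDegree hm'
    rw [Finsupp.sum_fintype _ _ fun _ => rfl] at this
    exact this.trans (htot j)
  · rw [eval_map_algebraMap, hAf]
  · rw [derivative_map, eval_map_algebraMap]
    exact aeval_derivative_ne_zero p hA hAf hmin

/-! ### Descent from a perfect extension to the base field. -/

theorem linearIndependent_map_powerSeries {k K : Type*} [Field k] [Field K] [Algebra k K] {M : ℕ}
    {g : Fin M → PowerSeries k} (hg : LinearIndependent k[X] g) :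
    LinearIndependent K[X] fun l => PowerSeries.map (algebraMap k K) (g l) := by
  by_contra hdep
  rw [Fintype.not_linearIndependent_iff] at hdep
  obtain ⟨c, hc, l₀, hl₀⟩ := hdep
  obtain ⟨a₀, ha₀⟩ : ∃ a, (c l₀).coeff a ≠ 0 := by
    by_contra! h; exact hl₀ (ext h)
  -- Applied coefficientwise, a `k`-linear `φ : K → k` carries the relation to one over `k[X]`,
  -- because the `g l` have coefficients in `k`; nonvanishing at one coefficient keeps it
  -- nontrivial.
  obtain ⟨φ, hφ⟩ := Module.Projective.exists_dual_ne_zero k ha₀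
  let c' : Fin M → k[X] := fun l => ∑ a ∈ (c l).support, monomial a (φ ((c l).coeff a))
  have hc' : ∀ l a, (c' l).coeff a = φ ((c l).coeff a) := by
    intro l a
    simp only [c', finsetSum_coeff, coeff_monomial, Finset.sum_ite_eq']
    split_ifs with h
    · rfl
    · rw [notMem_support_iff.1 h, map_zero]
  rw [Fintype.linearIndependent_iff] at hg
  have hzero := hg c' (by
    ext m
    have h := congrArg (fun u => φ (PowerSeries.coeff m u)) hc
    simp only [map_sum, Algebra.smul_def, PowerSeries.algebraMap_apply', Algebra.algebraMap_self,
      PowerSeries.map_id, PowerSeries.coeff_mul, map_zero, PowerSeries.coeff_map, id,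
      Polynomial.coeff_coe] at h ⊢
    rw [← h]
    refine Finset.sum_congr rfl fun l _ => Finset.sum_congr rfl fun x _ => ?_
    rw [hc', mul_comm ((c l).coeff x.1), ← Algebra.smul_def, map_smul, smul_eq_mul, mul_comm]) l₀
  have := hc' l₀ a₀
  rw [hzero, coeff_zero] at this
  exact hφ this.symm

theorem coe_map_mvPolynomial {σ k K : Type*} [Field k] [Field K] [Algebra k K]
    (b : MvPolynomial σ k) :
    (MvPolynomial.map (algebraMap k K) b : MvPowerSeries σ K) =
      MvPowerSeries.map (algebraMap k K) b := by
  ext m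
  rw [MvPolynomial.coeff_coe, MvPolynomial.coeff_map, MvPowerSeries.coeff_map,
    MvPolynomial.coeff_coe]

theorem aeval_map_eq_zero {σ k K : Type*} [Field k] [Field K] [Algebra k K]
    {f : MvPowerSeries σ k} {B : (MvPolynomial σ k)[X]} (hB : aeval f B = 0) :
    aeval (MvPowerSeries.map (algebraMap k K) f) (B.map (MvPolynomial.map (algebraMap k K))) = 0 := by
  rw [← map_aeval_eq_aeval_map (ψ := MvPowerSeries.map (algebraMap k K)), hB, map_zero]
  refine RingHom.ext fun b => ?_
  simpa [MvPowerSeries.algebraMap_apply'] using coe_map_mvPolynomial b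

theorem map_ne_zero_of_ne_zero {σ k K : Type*} [Field k] [Field K] [Algebra k K]
    {B : (MvPolynomial σ k)[X]} (hB : B ≠ 0) : B.map (MvPolynomial.map (algebraMap k K)) ≠ 0 :=
  (Polynomial.map_ne_zero_iff (MvPolynomial.map_injective _ (algebraMap k K).injective)).2 hB

theorem diagonal_map {n : ℕ} {k K : Type*} [Field k] [Field K] [Algebra k K]
    (f : MvPowerSeries (Fin n) k) :
    diagonal (MvPowerSeries.map (algebraMap k K) f) =
      PowerSeries.map (algebraMap k K) (diagonal f) := by
  ext m
  rw [PowerSeries.coeff_map, coeff_diagonal, coeff_diagonal, MvPowerSeries.coeff_map]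

theorem exists_degree_eq {R S : Type*} [CommRing R] [CommRing S] [Algebra R S] {f : S}
    (hf : IsAlgebraic R f) : ∃ A : R[X], A ≠ 0 ∧ aeval f A = 0 ∧ A.natDegree = degree R f := by
  obtain ⟨A, hA, hAf⟩ := hf
  exact Nat.sInf_mem (s := {m : ℕ | ∃ A : R[X], A ≠ 0 ∧ aeval f A = 0 ∧ A.natDegree = m})
    ⟨_, A, hA, hAf, rfl⟩

theorem degree_le {R S : Type*} [CommRing R] [CommRing S] [Algebra R S] {f : S} {A : R[X]}
    (hA : A ≠ 0) (hAf : aeval f A = 0) : degree R f ≤ A.natDegree :=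
  Nat.sInf_le ⟨A, hA, hAf, rfl⟩

theorem exists_totalDegT_eq {k : Type*} [Field k] {n : ℕ} {f : MvPowerSeries (Fin n) k}
    (hf : IsAlgebraic (MvPolynomial (Fin n) k) f) :
    ∃ A : (MvPolynomial (Fin n) k)[X], A ≠ 0 ∧ aeval f A = 0 ∧ totalDegT A = totalHeight f := by
  obtain ⟨A, hA, hAf⟩ := hf
  exact Nat.sInf_mem (s := {m : ℕ | ∃ A : (MvPolynomial (Fin n) k)[X],
    A ≠ 0 ∧ aeval f A = 0 ∧ totalDegT A = m}) ⟨_, A, hA, hAf, rfl⟩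

theorem exists_degT_eq {k : Type*} [Field k] {n : ℕ} {f : MvPowerSeries (Fin n) k}
    (hf : IsAlgebraic (MvPolynomial (Fin n) k) f) (i : Fin n) :
    ∃ A : (MvPolynomial (Fin n) k)[X], A ≠ 0 ∧ aeval f A = 0 ∧ degT i A = partialHeight f i := by
  obtain ⟨A, hA, hAf⟩ := hf
  exact Nat.sInf_mem (s := {m : ℕ | ∃ A : (MvPolynomial (Fin n) k)[X],
    A ≠ 0 ∧ aeval f A = 0 ∧ degT i A = m}) ⟨_, A, hA, hAf, rfl⟩

theorem totalDegree_coeff_le_totalDegT {k : Type*} [Field k] {n : ℕ}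
    (A : (MvPolynomial (Fin n) k)[X]) (j : ℕ) : (A.coeff j).totalDegree ≤ totalDegT A := by
  by_cases h : A.coeff j = 0
  · simp [h]
  · exact Finset.le_sup (f := fun j => (A.coeff j).totalDegree) (mem_support_iff.2 h)

theorem degreeOf_coeff_le_degT {k : Type*} [Field k] {n : ℕ} (i : Fin n)
    (A : (MvPolynomial (Fin n) k)[X]) (j : ℕ) : (A.coeff j).degreeOf i ≤ degT i A := by
  by_cases h : A.coeff j = 0
  · simp [h]
  · exact Finset.le_sup (f := fun j => (A.coeff j).degreeOf i) (mem_support_iff.2 h)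

/-- The annihilators realizing the three minima over `k` may differ; their images over `K` still
meet the bounds, so heights over `K` need not be compared. -/
theorem not_linearIndependent_diagonal_pow_of_isAlgebraic {k : Type*} (K : Type*) [Field k]
    [Field K] [Algebra k K] (p : ℕ) [Fact p.Prime] [CharP K p] [PerfectRing K p] {n : ℕ}
    (hn : 1 ≤ n) {f : MvPowerSeries (Fin n) k} (hf : IsAlgebraic (MvPolynomial (Fin n) k) f) :
    ¬ LinearIndependent k[X]
      fun l : Fin (degree (MvPolynomial (Fin n) k) f *
        (boundaryExp (partialHeight f) (totalHeight f)).card + 1) =>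
          diagonal f ^ p ^ (l : ℕ) := by
  have hd : ∃ B : (MvPolynomial (Fin n) K)[X], B ≠ 0 ∧
      aeval (MvPowerSeries.map (algebraMap k K) f) B = 0 ∧
      B.natDegree ≤ degree (MvPolynomial (Fin n) k) f := by
    obtain ⟨B, hB, hBf, hBd⟩ := exists_degree_eq hf
    exact ⟨_, map_ne_zero_of_ne_zero hB, aeval_map_eq_zero hBf, natDegree_map_le.trans hBd.le⟩
  have hh : ∃ B : (MvPolynomial (Fin n) K)[X], B ≠ 0 ∧
      aeval (MvPowerSeries.map (algebraMap k K) f) B = 0 ∧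
      ∀ j, (B.coeff j).totalDegree ≤ totalHeight f := by
    obtain ⟨B, hB, hBf, hBd⟩ := exists_totalDegT_eq hf
    refine ⟨_, map_ne_zero_of_ne_zero hB, aeval_map_eq_zero hBf, fun j => ?_⟩
    rw [coeff_map, ← hBd]
    have hsub := MvPolynomial.support_map_subset (algebraMap k K) (B.coeff j)
    exact le_trans (Finset.sup_mono hsub) (totalDegree_coeff_le_totalDegT B j)
  have hhs : ∀ i, ∃ B : (MvPolynomial (Fin n) K)[X], B ≠ 0 ∧
      aeval (MvPowerSeries.map (algebraMap k K) f) B = 0 ∧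
      ∀ j, (B.coeff j).degreeOf i ≤ partialHeight f i := by
    intro i
    obtain ⟨B, hB, hBf, hBd⟩ := exists_degT_eq hf i
    refine ⟨_, map_ne_zero_of_ne_zero hB, aeval_map_eq_zero hBf, fun j => ?_⟩
    rw [coeff_map, ← hBd]
    refine le_trans ?_ (degreeOf_coeff_le_degT i B j)
    rw [MvPolynomial.degreeOf_le_iff]
    intro m hm
    exact MvPolynomial.le_degreeOf_of_mem_support i (MvPolynomial.support_map_subset _ _ hm)
  have key := not_linearIndependent_diagonal_pow_of_annihilators p hn hd hh hhs
  intro hli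
  apply key
  have := linearIndependent_map_powerSeries (K := K) hli
  simpa only [diagonal_map, map_pow] using this

/-- Every term is divisible by `g`; cancelling it when `g ≠ 0` lowers each exponent to `p ^ j - 1`.
For `g = 0` the polynomial `y` serves, since `p ^ N ≥ 2`. -/
theorem exists_annihilator_of_frobenius_relation {R S : Type*} [CommRing R] [IsDomain R]
    [CommRing S] [IsDomain S] [Algebra R S] {p : ℕ} (hp : 2 ≤ p) {g : S} {N : ℕ} (hN : 1 ≤ N)
    {c : ℕ → R} (hc : ∃ j ∈ Finset.range (N + 1), c j ≠ 0)
    (h : ∑ j ∈ Finset.range (N + 1), algebraMap R S (c j) * g ^ p ^ j = 0) :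
    ∃ A : R[X], A ≠ 0 ∧ aeval g A = 0 ∧ A.natDegree ≤ p ^ N - 1 := by
  have hpos : ∀ j, 1 ≤ p ^ j := fun j => Nat.one_le_pow _ _ (by omega)
  by_cases hg : g = 0
  · refine ⟨X, X_ne_zero, by simp [hg], ?_⟩
    have : p ^ 1 ≤ p ^ N := Nat.pow_le_pow_right (by omega) hN
    rw [natDegree_X]
    rw [pow_one] at this
    omega
  · refine ⟨∑ j ∈ Finset.range (N + 1), monomial (p ^ j - 1) (c j), ?_, ?_, ?_⟩
    · obtain ⟨l, hl, hcl⟩ := hc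
      intro h0
      have := congrArg (fun P => P.coeff (p ^ l - 1)) h0
      simp only [finsetSum_coeff, coeff_monomial, coeff_zero] at this
      rw [Finset.sum_eq_single l] at this
      · exact hcl (by simpa using this)
      · intro j _ hjl
        rw [if_neg]
        intro he
        have h1 := hpos j
        have h2 := hpos l
        exact hjl (Nat.pow_right_injective hp (by simp only; omega))
      · exact fun h' => absurd hl h'
    · refine (mul_eq_zero.1 ?_).resolve_right hg
      rw [← h, map_sum, Finset.sum_mul]
      refine Finset.sum_congr rfl fun j _ => ?_
      rw [aeval_monomial, mul_assoc, ← pow_succ, Nat.sub_add_cancel (hpos j)]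
    · refine natDegree_sum_le_of_forall_le _ _ fun j hj => (natDegree_monomial_le _).trans ?_
      exact Nat.sub_le_sub_right (Nat.pow_le_pow_right (by omega)
        (Nat.lt_succ_iff.1 (Finset.mem_range.1 hj))) 1

end AlgSeries

theorem theorem4 {k : Type*} [Field k] (p : ℕ) [Fact p.Prime] [CharP k p]
    (n : ℕ) (hn : 1 ≤ n) (f : MvPowerSeries (Fin n) k)
    (hf : IsAlgebraic (MvPolynomial (Fin n) k) f)
    (d h : ℕ) (hs : Fin n → ℕ)
    (hd : d = AlgSeries.degree (MvPolynomial (Fin n) k) f)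
    (hh : h = AlgSeries.totalHeight f)
    (hhs : ∀ i, hs i = AlgSeries.partialHeight f i)
    (N : ℕ)
    (hN : N = (d + 1) * min ((∏ i, (hs i + 1)) - ∏ i, hs i) ((n + h).choose n - h.choose n)) :
    (∃ c : ℕ → Polynomial k,
      (∃ j ∈ Finset.range (N + 1), c j ≠ 0) ∧
      ∑ j ∈ Finset.range (N + 1),
        (c j : PowerSeries k) * AlgSeries.diagonal f ^ (p ^ j) = 0) ∧
    IsAlgebraic (Polynomial k) (AlgSeries.diagonal f) ∧
    AlgSeries.degree (Polynomial k) (AlgSeries.diagonal f) ≤ p ^ N - 1 := by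
  obtain rfl : hs = AlgSeries.partialHeight f := funext hhs
  have hp : 2 ≤ p := (Fact.out : p.Prime).two_le
  set b := (AlgSeries.boundaryExp (AlgSeries.partialHeight f) h).card with hb
  have hbmin : b ≤ min ((∏ i, (AlgSeries.partialHeight f i + 1)) - ∏ i, AlgSeries.partialHeight f i)
      ((n + h).choose n - h.choose n) :=
    le_min (AlgSeries.card_boundaryExp_le_box _ _) (AlgSeries.card_boundaryExp_le_simplex _ _)
  -- The zero exponent is always counted, which makes `N` positive.
  have hbpos : 1 ≤ b := by
    refine Finset.card_pos.2 ⟨0, AlgSeries.mem_boundaryExp.2 ⟨?_, fun i => ?_, ⟨0, hn⟩, rfl⟩⟩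
    · simp
    · simp
  have hdN : d * b ≤ N := hN ▸ Nat.mul_le_mul (Nat.le_succ d) hbmin
  have hN1 : 1 ≤ N := by
    rw [hN]
    exact Nat.mul_pos (Nat.succ_pos d) (hbpos.trans hbmin)
  have hrel : ∃ c : ℕ → Polynomial k, (∃ j ∈ Finset.range (N + 1), c j ≠ 0) ∧
      ∑ j ∈ Finset.range (N + 1),
        (c j : PowerSeries k) * AlgSeries.diagonal f ^ (p ^ j) = 0 := by
    have : CharP (AlgebraicClosure k) p :=
      charP_of_injective_algebraMap (algebraMap k (AlgebraicClosure k)).injective p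
    have : PerfectRing (AlgebraicClosure k) p := PerfectField.toPerfectRing p
    have hdep := AlgSeries.not_linearIndependent_diagonal_pow_of_isAlgebraic
      (AlgebraicClosure k) p hn hf
    rw [← hd, ← hh, ← hb, Fintype.not_linearIndependent_iff] at hdep
    obtain ⟨c, hc, i, hi⟩ := hdep
    -- The relation found stops at `d * b ≤ N`; it is padded with zeros.
    refine ⟨fun j => if hj : j < d * b + 1 then c ⟨j, hj⟩ else 0,
      ⟨i, Finset.mem_range.2 (by omega), by
        simp only [i.2, dif_pos]
        exact hi⟩, ?_⟩
    rw [← Finset.sum_subset (s₁ := Finset.range (d * b + 1)), Finset.sum_range, ← hc]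
    · refine Finset.sum_congr rfl fun l _ => ?_
      simp only [l.2, dif_pos, Algebra.smul_def]
      simp [PowerSeries.algebraMap_apply']
    · exact Finset.range_subset_range.2 (by omega)
    · intro j _ hj
      have hj' : ¬ j < d * b + 1 := fun h => hj (Finset.mem_range.2 h)
      simp [hj']
  refine ⟨hrel, ?_⟩
  obtain ⟨c, hc, hsum⟩ := hrel
  obtain ⟨A, hA, hAf, hAd⟩ := AlgSeries.exists_annihilator_of_frobenius_relation hp hN1 hc
    (g := AlgSeries.diagonal f) (by simpa [PowerSeries.algebraMap_apply'] using hsum)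
  exact ⟨⟨A, hA, hAf⟩, (AlgSeries.degree_le hA hAf).trans hAd⟩
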